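/- Let $\mathfrak{A}$ be a unital C*-algebra. A state of $\mathfrak{A}$ is a positive linear functional $\psi$ on $\mathfrak{A}$ with $\psi(1)=1$, and a pure state is an extreme point of the set of states. For a representation $\pi$ of $\mathfrak{A}$ on a complex Hilbert space $\mathcal{H}$ (a *-homomorphism $\pi:\mathfrak{A}\to\mathbb{B}(\mathcal{H})$ with $\pi(1)=1$) and a state $\psi$ put \[ S(\pi,\psi)=\{x\in\mathcal{H} : \psi(A)=\langle x,\pi(A)x\rangle \text{ for all } A\in\mathfrak{A}\}. \] For states $\psi,\phi$ let $F_\pi(\psi,\phi)=0$ if $S(\pi,\psi)$ or $S(\pi,\phi)$ is empty, and otherwise \[ F_\pi(\psi,\phi)=\sup\{|\langle x,y\rangle| : x\in S(\pi,\psi),\ y\in S(\pi,\phi)\}. \] The Bures fidelity is $F(\psi,\phi)=\sup_\pi F_\pi(\psi,\phi)$, the supremum being taken over all representations $\pi$ of $\mathfrak{A}$. The Roberts--Roepstorff transition probability of pure states $\psi,\phi$ is $\psi\cdot\phi=1-\frac14\|\psi-\phi\|^2$, where $\|\cdot\|$ is the norm of the dual of $\mathfrak{A}$. Then for all pure states $\psi$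 and $\phi$ of $\mathfrak{A}$, \[ \psi\cdot\phi=F(\psi,\phi)^2 . \] -/

import Mathlib

open scoped ComplexOrder InnerProductSpace

universe u

namespace CStarState

/-- The state space of a unital C*-algebra `A`: the positive linear functionals `ψ` on `A` with
`ψ 1 = 1`.  (Positive functionals are automatically continuous; here they are elements of the
Banach dual, so that `‖ψ - φ‖` is the norm of the dual.  In the order of `ℂ` used here,
`0 ≤ z` says that `z` is real and non-negative.) -/
def stateSpace (A : Type u) [CStarAlgebra A] : Set (StrongDual ℂ A) :=
  {ψ | (∀ a : A, 0 ≤ ψ (star a * a)) ∧ ψ 1 = 1}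

/-- A pure state is an extreme point of the state space. -/
def IsPureState {A : Type u} [CStarAlgebra A] (ψ : StrongDual ℂ A) : Prop :=
  ψ ∈ Set.extremePoints ℝ (stateSpace A)

section Representation

variable {A : Type u} [CStarAlgebra A]
  {H : Type u} [NormedAddCommGroup H] [InnerProductSpace ℂ H] [CompleteSpace H]

/-- The set `S(π, ψ)` of vectors `x` of the representation space of `π` with
`ψ a = ⟨x, π a x⟩` for all `a`. -/
def implementingVectors (π : A →⋆ₐ[ℂ] (H →L[ℂ] H)) (ψ : StrongDual ℂ A) : Set H :=
  {x | ∀ a : A, ψ a = ⟪x, π a x⟫_ℂ}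

/-- The numbers `|⟨x, y⟩|` with `x ∈ S(π, ψ)` and `y ∈ S(π, φ)`. -/
def overlaps (π : A →⋆ₐ[ℂ] (H →L[ℂ] H)) (ψ φ : StrongDual ℂ A) : Set ℝ :=
  {r | ∃ x ∈ implementingVectors π ψ, ∃ y ∈ implementingVectors π φ, r = ‖⟪x, y⟫_ℂ‖}

open Classical in
/-- The fidelity `F_π(ψ, φ)` of two states relative to the representation `π`. -/
noncomputable def fidelityIn (π : A →⋆ₐ[ℂ] (H →L[ℂ] H)) (ψ φ : StrongDual ℂ A) : ℝ :=
  if implementingVectors π ψ = ∅ ∨ implementingVectors π φ = ∅ then 0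
  else sSup (overlaps π ψ φ)

lemma norm_eq_one_of_mem {π : A →⋆ₐ[ℂ] (H →L[ℂ] H)} {ψ : StrongDual ℂ A}
    (hψ : ψ ∈ stateSpace A) {x : H} (hx : x ∈ implementingVectors π ψ) : ‖x‖ = 1 := by
  have h := hx 1
  rw [hψ.2, map_one, one_apply_eq_self] at h
  have h2 : ‖x‖ ^ 2 = 1 := by
    rw [norm_sq_eq_re_inner (𝕜 := ℂ) x, ← h]
    simp
  exact (pow_eq_one_iff_of_nonneg (norm_nonneg x) two_ne_zero).1 h2

lemma overlaps_le_one {π : A →⋆ₐ[ℂ] (H →L[ℂ] H)} {ψ φ : StrongDual ℂ A}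
    (hψ : ψ ∈ stateSpace A) (hφ : φ ∈ stateSpace A) {r : ℝ} (hr : r ∈ overlaps π ψ φ) :
    r ≤ 1 := by
  obtain ⟨x, hx, y, hy, rfl⟩ := hr
  have h := norm_inner_le_norm (𝕜 := ℂ) x y
  rwa [norm_eq_one_of_mem hψ hx, norm_eq_one_of_mem hφ hy, one_mul] at h

lemma fidelityIn_le_one (π : A →⋆ₐ[ℂ] (H →L[ℂ] H)) {ψ φ : StrongDual ℂ A}
    (hψ : ψ ∈ stateSpace A) (hφ : φ ∈ stateSpace A) : fidelityIn π ψ φ ≤ 1 := by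
  unfold fidelityIn
  split_ifs with h
  · exact zero_le_one
  · exact Real.sSup_le (fun r hr => overlaps_le_one hψ hφ hr) zero_le_one

end Representation

/-- The numbers `F_π(ψ, φ)`, where `π` runs over all representations of `A` (unital
*-homomorphisms into the bounded operators on a complex Hilbert space).  Hilbert spaces in the
universe of `A` suffice: two vectors `x` and `y` of any representation lie in the closure of
`{π a x + π b y | a b : A}`, an invariant subspace with a dense image of `A × A`, which therefore
has a copy in the universe of `A`. -/
def fidelityValues {A : Type u} [CStarAlgebra A] (ψ φ : StrongDual ℂ A) : Set ℝ :=
  {r | ∃ (H : Type u) (_ : NormedAddCommGroup H) (_ : InnerProductSpace ℂ H)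
      (_ : CompleteSpace H) (π : A →⋆ₐ[ℂ] (H →L[ℂ] H)), r = fidelityIn π ψ φ}

/-- The Bures fidelity `F(ψ, φ)`: the supremum of `F_π(ψ, φ)` over all representations `π`. -/
noncomputable def fidelity {A : Type u} [CStarAlgebra A] (ψ φ : StrongDual ℂ A) : ℝ :=
  sSup (fidelityValues ψ φ)

/-- For states, the supremum defining `F(ψ, φ)` is taken over a set bounded above by `1`. -/
lemma bddAbove_fidelityValues {A : Type u} [CStarAlgebra A] {ψ φ : StrongDual ℂ A}
    (hψ : ψ ∈ stateSpace A) (hφ : φ ∈ stateSpace A) : BddAbove (fidelityValues ψ φ) := by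
  refine ⟨1, ?_⟩
  rintro r ⟨H, _, _, _, π, rfl⟩
  exact fidelityIn_le_one π hψ hφ

/-- The Roberts–Roepstorff transition probability `ψ · φ` of two pure states. -/
noncomputable def transitionProbability {A : Type u} [CStarAlgebra A]
    (ψ φ : StrongDual ℂ A) : ℝ :=
  1 - (1 / 4) * ‖ψ - φ‖ ^ 2

end CStarState

/-! Put `d = ‖ψ - φ‖ / 2`, so that `ψ · φ = 1 - d²`. The bound `F² ≤ 1 - d²` holds for all states:
the functionals of unit vectors `x`, `y` differ in norm by at most `2√(1 - |⟨x, y⟩|²)`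
(`norm_vector_functional_sub_le`).

For the converse, `ψ` and `φ` are both dominated by one positive functional `σ` of mass `1 + d`
(`exists_dominating`). Its cyclic vector `z` is carried by intertwining contractions `U`, `V` to
cyclic vectors `x` of `ψ` and `y` of `φ`. By purity (Schur) `V U†` is `√c` times an isometry, so if
`c > 0` then `w = V U† x` is `√c` times a vector of `ψ` in the representation of `φ`, whence `|⟨y,
w⟩| ≤ √c F`. Since `y - w = V (1 - U† U) z`, `norm_defect_sq_le` gives `‖y - w‖² ≤ (1 - c) d`, that
is, `2 Re⟨y, w⟩ ≥ (1 - d) + c (1 + d)`. The AM-GM inequality then yields `F² ≥ 1 - d²`. -/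

open CStarState ContinuousLinearMap

/-! ### Cyclic representations, intertwiners and Schur's lemma -/

section Intertwiners

variable {A : Type u} [CStarAlgebra A]

/-- Every positive functional on a unital C*-algebra is a vector functional of a cyclic
representation. -/
theorem exists_cyclic_representation (f : A →ₗ[ℂ] ℂ) (hf : ∀ a, 0 ≤ f (star a * a)) :
    ∃ (H : Type u) (_ : NormedAddCommGroup H) (_ : InnerProductSpace ℂ H) (_ : CompleteSpace H)
      (π : A →⋆ₐ[ℂ] (H →L[ℂ] H)) (ξ : H),
      DenseRange (fun a => π a ξ) ∧ ∀ a, f a = ⟪ξ, π a ξ⟫_ℂ := by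
  let _ := CStarAlgebra.spectralOrder A
  let _ := CStarAlgebra.spectralOrderedRing A
  let g : A →ₚ[ℂ] ℂ := PositiveLinearMap.mk₀ f (by
    intro x hx
    obtain ⟨b, rfl⟩ := CStarAlgebra.nonneg_iff_eq_star_mul_self.1 hx
    exact hf b)
  have key (a : A) : g.gnsStarAlgHom a ((g.toPreGNS 1 : g.PreGNS) : g.GNS) =
      ((g.toPreGNS a : g.PreGNS) : g.GNS) := by
    change g.gnsNonUnitalStarAlgHom a _ = _
    rw [PositiveLinearMap.gnsNonUnitalStarAlgHom_apply_coe]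
    simp
  refine ⟨g.GNS, inferInstance, inferInstance, inferInstance, g.gnsStarAlgHom,
    ((g.toPreGNS 1 : g.PreGNS) : g.GNS), ?_, fun a => ?_⟩
  · simp only [key]
    exact (UniformSpace.Completion.denseRange_coe).comp g.toPreGNS.surjective.denseRange
      (UniformSpace.Completion.continuous_coe _)
  · rw [key, UniformSpace.Completion.inner_coe, PositiveLinearMap.preGNS_inner_def]
    simp
    rfl

variable {H K : Type u} [NormedAddCommGroup H] [InnerProductSpace ℂ H] [CompleteSpace H]
  [NormedAddCommGroup K] [InnerProductSpace ℂ K] [CompleteSpace K]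
  {π : A →⋆ₐ[ℂ] (H →L[ℂ] H)} {ρ : A →⋆ₐ[ℂ] (K →L[ℂ] K)}

theorem inner_map_apply_map_apply (π : A →⋆ₐ[ℂ] (H →L[ℂ] H)) (ξ : H) (a b : A) :
    ⟪π a ξ, π b ξ⟫_ℂ = ⟪ξ, π (star a * b) ξ⟫_ℂ := by
  rw [map_mul, map_star, mul_apply_eq_comp, star_eq_adjoint, adjoint_inner_right]

/-- The norm inequality makes `π a ξ ↦ ρ a η` well defined and contractive on a dense subspace, so
it extends by continuity. -/
theorem exists_intertwiner {ξ : H} {η : K} (hξ : DenseRange fun a => π a ξ)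
    (h : ∀ a, ‖ρ a η‖ ≤ ‖π a ξ‖) :
    ∃ V : H →L[ℂ] K, ‖V‖ ≤ 1 ∧ V ξ = η ∧ ∀ a x, V (π a x) = ρ a (V x) := by
  let e : A →ₗ[ℂ] H :=
    { toFun := fun a => π a ξ, map_add' := by simp, map_smul' := by simp }
  let f : A →ₗ[ℂ] K :=
    { toFun := fun a => ρ a η, map_add' := by simp, map_smul' := by simp }
  have he : DenseRange e := hξ
  have hb : ∀ a, ‖f a‖ ≤ 1 * ‖e a‖ := fun a => by rw [one_mul]; exact h a
  have hV (a : A) : f.extendOfNorm e (π a ξ) = ρ a η :=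
    LinearMap.extendOfNorm_eq he ⟨1, hb⟩ a
  refine ⟨f.extendOfNorm e, LinearMap.opNorm_extendOfNorm_le he zero_le_one hb, ?_, ?_⟩
  · simpa using hV 1
  · intro a x
    refine hξ.induction_on (p := fun x => f.extendOfNorm e (π a x) = ρ a (f.extendOfNorm e x)) x
      (isClosed_eq (by fun_prop) (by fun_prop)) fun b => ?_
    rw [hV, ← mul_apply_eq_comp, ← map_mul, hV, map_mul, mul_apply_eq_comp]

theorem adjoint_intertwines {V : H →L[ℂ] K} (hV : ∀ a x, V (π a x) = ρ a (V x)) (a : A) (y : K) :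
    adjoint V (ρ a y) = π a (adjoint V y) := by
  refine ext_inner_left ℂ fun x => ?_
  have h1 : adjoint (ρ a) = ρ (star a) := by rw [map_star, star_eq_adjoint]
  have h2 : adjoint (π a) = π (star a) := by rw [map_star, star_eq_adjoint]
  rw [adjoint_inner_right, ← adjoint_inner_left (ρ a), ← adjoint_inner_left (π a), h1, h2, ← hV,
    adjoint_inner_right]

/-- `ψ` is the convex combination of the states `g / t` and `(ψ - g) / (1 - t)` with weights `t` and
`1 - t`; extremality forces `g / t = ψ`. -/
theorem IsPureState.eq_smul_of_le {ψ g : StrongDual ℂ A} (hψ : IsPureState ψ) {t : ℝ}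
    (ht0 : 0 < t) (ht1 : t < 1) (hg1 : g 1 = t) (hg : ∀ a, 0 ≤ g (star a * a))
    (hgψ : ∀ a, g (star a * a) ≤ ψ (star a * a)) : g = (t : ℂ) • ψ := by
  have ht : (t : ℂ) ≠ 0 := by exact_mod_cast ht0.ne'
  have ht' : ((1 - t : ℝ) : ℂ) ≠ 0 := by exact_mod_cast (sub_pos.2 ht1).ne'
  have h1 : ((t⁻¹ : ℝ) : ℂ) • g ∈ stateSpace A := by
    refine ⟨fun a => ?_, ?_⟩
    · exact mul_nonneg (by exact_mod_cast (inv_pos.2 ht0).le) (hg a)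
    · simp [hg1, ht]
  have h2 : (((1 - t)⁻¹ : ℝ) : ℂ) • (ψ - g) ∈ stateSpace A := by
    refine ⟨fun a => ?_, ?_⟩
    · exact mul_nonneg (by exact_mod_cast (inv_pos.2 (sub_pos.2 ht1)).le)
        (by simpa using hgψ a)
    · have := hψ.1.2
      push_cast at ht'
      simp [hg1, this, ht']
  have h3 : ψ ∈ openSegment ℝ (((t⁻¹ : ℝ) : ℂ) • g) ((((1 - t)⁻¹ : ℝ) : ℂ) • (ψ - g)) := by
    refine ⟨t, 1 - t, ht0, sub_pos.2 ht1, by ring, ?_⟩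
    ext a
    push_cast at ht'
    simp [ht, ht']
  have h4 := hψ.2 h1 h2 h3
  rw [← h4, smul_smul]
  simp [ht]

/-- Schur's lemma for the cyclic representation of a pure state. -/
theorem IsPureState.adjoint_comp_self_eq_smul {ψ : StrongDual ℂ A} (hψ : IsPureState ψ) {ξ : H}
    (hξ : DenseRange fun a => π a ξ) (hξψ : ξ ∈ implementingVectors π ψ) {W : H →L[ℂ] K}
    (hW1 : ‖W‖ ≤ 1) (hW : ∀ a x, W (π a x) = ρ a (W x)) :
    ∃ t : ℝ, 0 ≤ t ∧ ∀ x y, ⟪W x, W y⟫_ℂ = t * ⟪x, y⟫_ℂ := by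
  have hn : ‖ξ‖ = 1 := norm_eq_one_of_mem hψ.1 hξψ
  have hle (x : H) : ‖W x‖ ≤ ‖x‖ := by simpa using W.le_of_opNorm_le hW1 x
  let g : StrongDual ℂ A :=
    LinearMap.mkContinuous
      { toFun := fun a => ⟪W ξ, ρ a (W ξ)⟫_ℂ
        map_add' := by simp
        map_smul' := by simp } 1 (by
      intro a
      have h1 : ‖W ξ‖ ≤ 1 := (hle ξ).trans hn.le
      have h2 : ‖ρ a‖ ≤ ‖a‖ := NonUnitalStarAlgHom.norm_apply_le ρ a
      calc ‖⟪W ξ, ρ a (W ξ)⟫_ℂ‖ ≤ ‖W ξ‖ * ‖ρ a (W ξ)‖ := norm_inner_le_norm _ _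
        _ ≤ 1 * (‖a‖ * 1) := by
          gcongr
          exact (ρ a).le_of_opNorm_le_of_le h2 h1
        _ = 1 * ‖a‖ := by ring)
  have hg (a : A) : g a = ⟪W ξ, ρ a (W ξ)⟫_ℂ := rfl
  have hgs (a : A) : g (star a * a) = ((‖W (π a ξ)‖ ^ 2 : ℝ) : ℂ) := by
    rw [hg, ← inner_map_apply_map_apply, ← hW, inner_self_eq_norm_sq_to_K]
    norm_cast
  have hψs (a : A) : ψ (star a * a) = ((‖π a ξ‖ ^ 2 : ℝ) : ℂ) := by
    rw [hξψ, ← inner_map_apply_map_apply, inner_self_eq_norm_sq_to_K]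
    norm_cast
  have hg1 : g 1 = ((‖W ξ‖ ^ 2 : ℝ) : ℂ) := by simpa using hgs 1
  have hψs1 : ‖W ξ‖ ^ 2 ≤ 1 := pow_le_one₀ (norm_nonneg _) ((hle ξ).trans hn.le)
  -- As `W` is a contraction, `g ≤ ψ`. Purity applies when the mass of `g` is strictly between 0 and
  -- 1; at mass 1, equality in the contraction bound gives `W† W ξ = ξ`.
  have hgψ : g = ((‖W ξ‖ ^ 2 : ℝ) : ℂ) • ψ := by
    rcases (sq_nonneg ‖W ξ‖).eq_or_lt with h0 | h0
    · have : W ξ = 0 := by simpa using h0.symm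
      ext a
      simp [hg, this]
    rcases hψs1.eq_or_lt with h1 | h1
    · have h2 : adjoint W (W ξ) = ξ := by
        rw [← sub_eq_zero, ← norm_eq_zero, ← sq_eq_zero_iff]
        have h3 : ‖adjoint W (W ξ)‖ ≤ 1 := by
          have := (adjoint W).le_of_opNorm_le (by simpa using hW1) (W ξ)
          have h4 := hle ξ
          linarith
        have h5 : RCLike.re ⟪adjoint W (W ξ), ξ⟫_ℂ = 1 := by
          rw [adjoint_inner_left, inner_self_eq_norm_sq, h1]
        have h6 := norm_sub_sq (𝕜 := ℂ) (adjoint W (W ξ)) ξ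
        rw [h5, hn] at h6
        nlinarith [sq_nonneg ‖adjoint W (W ξ) - ξ‖, norm_nonneg (adjoint W (W ξ))]
      ext a
      rw [h1, hg, ← hW, ← adjoint_inner_left, h2, ← hξψ]
      simp
    · exact IsPureState.eq_smul_of_le hψ h0 h1 hg1
        (fun a => by rw [hgs, Complex.zero_le_real]; exact sq_nonneg _)
        (fun a => by
          rw [hgs, hψs]
          exact Complex.real_le_real.2 (pow_le_pow_left₀ (norm_nonneg _) (hle _) 2))
  refine ⟨‖W ξ‖ ^ 2, sq_nonneg _, fun x y => ?_⟩
  refine hξ.induction_on₂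
    (p := fun x y => ⟪W x, W y⟫_ℂ = ((‖W ξ‖ ^ 2 : ℝ) : ℂ) * ⟪x, y⟫_ℂ)
    (isClosed_eq (by fun_prop) (by fun_prop)) (fun a b => ?_) x y
  rw [hW, hW, inner_map_apply_map_apply, inner_map_apply_map_apply, ← hg, hgψ, ← hξψ]
  simp

end Intertwiners

/-! ### Norm estimates and a common dominating functional -/

section Bounds

variable {A : Type u} [CStarAlgebra A]

theorem norm_vector_functional_sub_le {H : Type*} [NormedAddCommGroup H] [InnerProductSpace ℂ H]
    (B : H →L[ℂ] H) {x y : H} (hx : ‖x‖ = 1) (hy : ‖y‖ = 1) :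
    ‖⟪x, B x⟫_ℂ - ⟪y, B y⟫_ℂ‖ ≤ 2 * ‖B‖ * √(1 - ‖⟪x, y⟫_ℂ‖ ^ 2) := by
  -- A change of phase of `y` leaves its vector functional alone and makes `⟨x, y⟩` real and
  -- non-negative.
  obtain ⟨c, hc, hcr⟩ : ∃ c : ℂ, ‖c‖ = 1 ∧ c * ⟪x, y⟫_ℂ = ‖⟪x, y⟫_ℂ‖ := by
    by_cases h : ⟪x, y⟫_ℂ = 0
    · exact ⟨1, by simp, by simp [h]⟩
    · refine ⟨‖⟪x, y⟫_ℂ‖ / ⟪x, y⟫_ℂ, ?_, div_mul_cancel₀ _ h⟩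
      rw [norm_div, Complex.norm_real, norm_norm, div_self (by simpa using h)]
  set r := ‖⟪x, y⟫_ℂ‖ with hr
  set z := c • y with hz
  have hzn : ‖z‖ = 1 := by rw [hz, norm_smul, hc, hy, one_mul]
  have hxz : ⟪x, z⟫_ℂ = r := by rw [hz, inner_smul_right, hcr]
  have hzz : ⟪z, B z⟫_ℂ = ⟪y, B y⟫_ℂ := by
    rw [hz, map_smul, inner_smul_left, inner_smul_right, ← mul_assoc, mul_comm _ c,
      Complex.mul_conj, Complex.normSq_eq_norm_sq, hc]
    simp
  have hsub : ‖x - z‖ ^ 2 = 2 * (1 - r) := by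
    rw [norm_sub_sq (𝕜 := ℂ), hxz, hx, hzn]
    simp; ring
  have hadd : ‖x + z‖ ^ 2 = 2 * (1 + r) := by
    rw [norm_add_sq (𝕜 := ℂ), hxz, hx, hzn]
    simp; ring
  have hprod : ‖x - z‖ * ‖x + z‖ = 2 * √(1 - r ^ 2) := by
    rw [← Real.sqrt_sq (mul_nonneg (norm_nonneg (x - z)) (norm_nonneg (x + z))), mul_pow, hsub,
      hadd, show 2 * (1 - r) * (2 * (1 + r)) = 2 ^ 2 * (1 - r ^ 2) by ring,
      Real.sqrt_mul (by norm_num), Real.sqrt_sq (by norm_num)]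
  have hpol : ⟪x, B x⟫_ℂ - ⟪z, B z⟫_ℂ =
      (1 / 2 : ℂ) * (⟪x - z, B (x + z)⟫_ℂ + ⟪x + z, B (x - z)⟫_ℂ) := by
    simp only [map_add, map_sub, inner_add_left, inner_add_right, inner_sub_left, inner_sub_right]
    ring
  have hb (u v : H) : ‖⟪u, B v⟫_ℂ‖ ≤ ‖B‖ * (‖u‖ * ‖v‖) := by
    calc _ ≤ ‖u‖ * ‖B v‖ := norm_inner_le_norm _ _
      _ ≤ ‖u‖ * (‖B‖ * ‖v‖) := by gcongr; exact B.le_opNorm v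
      _ = _ := by ring
  have h1 := hb (x - z) (x + z)
  have h2 := hb (x + z) (x - z)
  rw [mul_comm ‖x + z‖] at h2
  rw [hprod] at h1 h2
  rw [← hzz, hpol, norm_mul]
  have h3 := norm_add_le ⟪x - z, B (x + z)⟫_ℂ ⟪x + z, B (x - z)⟫_ℂ
  rw [norm_div, norm_one, Complex.norm_ofNat]
  linarith

theorem overlap_sq_le {H : Type u} [NormedAddCommGroup H] [InnerProductSpace ℂ H] [CompleteSpace H]
    {π : A →⋆ₐ[ℂ] (H →L[ℂ] H)} {ψ φ : StrongDual ℂ A} (hψ : ψ ∈ stateSpace A)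
    (hφ : φ ∈ stateSpace A) {r : ℝ} (hr : r ∈ overlaps π ψ φ) :
    r ^ 2 ≤ transitionProbability ψ φ := by
  have hr1 := overlaps_le_one hψ hφ hr
  obtain ⟨x, hx, y, hy, rfl⟩ := hr
  have h : ‖ψ - φ‖ ≤ 2 * √(1 - ‖⟪x, y⟫_ℂ‖ ^ 2) := by
    refine opNorm_le_bound _ (by positivity) fun a => ?_
    have h1 : ‖π a‖ ≤ ‖a‖ := NonUnitalStarAlgHom.norm_apply_le π a
    rw [sub_apply, hx a, hy a]
    refine (norm_vector_functional_sub_le (π a) (norm_eq_one_of_mem hψ hx)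
      (norm_eq_one_of_mem hφ hy)).trans ?_
    rw [mul_right_comm]
    gcongr
  have h2 := pow_le_pow_left₀ (norm_nonneg _) h 2
  rw [mul_pow, Real.sq_sqrt (by nlinarith [norm_nonneg ⟪x, y⟫_ℂ])] at h2
  unfold transitionProbability
  linarith

section Order

variable [PartialOrder A] [StarOrderedRing A]

/-- `v (t - v) ≥ 0` because the factors commute, and this product is `(t/2)² - (v - t/2)²`. -/
theorem norm_sub_algebraMap_le_half {v : A} {t : ℝ} (h0 : 0 ≤ v) (h1 : v ≤ algebraMap ℝ A t)
    (ht : 0 ≤ t) :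
    ‖v - algebraMap ℝ A (t / 2)‖ ≤ t / 2 := by
  have hc : Commute v (algebraMap ℝ A t - v) :=
    Commute.sub_right (Algebra.commutes t v).symm (Commute.refl v)
  have hsa : IsSelfAdjoint (v - algebraMap ℝ A (t / 2)) :=
    (IsSelfAdjoint.of_nonneg h0).sub (IsSelfAdjoint.algebraMap A (.all _))
  have h2 : star (v - algebraMap ℝ A (t / 2)) * (v - algebraMap ℝ A (t / 2)) ≤
      algebraMap ℝ A ((t / 2) ^ 2) := by
    rw [← sub_nonneg]
    convert hc.mul_nonneg h0 (sub_nonneg.2 h1) using 1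
    rw [hsa.star_eq]
    have : algebraMap ℝ A t = algebraMap ℝ A (t / 2) + algebraMap ℝ A (t / 2) := by
      rw [← map_add]; congr 1; ring
    rw [this, pow_two, map_mul]
    have hcc := Algebra.commutes (t / 2) v
    simp only [mul_sub, sub_mul, mul_add, hcc]
    abel
  have h3 := (CStarAlgebra.norm_le_iff_le_algebraMap _ (sq_nonneg (t / 2))
    (star_mul_self_nonneg _)).2 h2
  rw [CStarRing.norm_star_mul_self, ← sq] at h3
  exact abs_le_of_sq_le_sq' h3 (by linarith) |>.2

/-- A functional `ω` with `ω 1 = 0` is dominated on the positive cone by a positive functional of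
mass `‖ω‖ / 2`; this follows from Riesz' extension theorem. -/
theorem exists_real_dominating {ω φ : StrongDual ℂ A} (hφ : ∀ a, 0 ≤ a → 0 ≤ φ a) (hφ1 : φ 1 = 1)
    (hω1 : ω 1 = 0) :
    ∃ σ : selfAdjoint A →ₗ[ℝ] ℝ, σ 1 = ‖ω‖ / 2 ∧
      ∀ b : selfAdjoint A, 0 ≤ (b : A) → 0 ≤ σ b ∧ (ω b).re ≤ σ b := by
  let inc : selfAdjoint A →ₗ[ℝ] A := (selfAdjoint.submodule ℝ A).subtype
  let w (χ : StrongDual ℂ A) : selfAdjoint A →ₗ[ℝ] ℝ :=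
    Complex.reLm ∘ₗ (χ.toLinearMap.restrictScalars ℝ) ∘ₗ inc
  have hw (χ : StrongDual ℂ A) (b : selfAdjoint A) : w χ b = (χ b).re := rfl
  -- Passing to pairs yields both parts of a Jordan decomposition at once: the extension `g` gives
  -- positive functionals `b ↦ g (b, 0)` and `b ↦ g (0, b)` with difference `Re ω`. On `E`, where `u
  -- + v = t`, the form `F` is `t ‖ω‖ / 2 - Re ω v`; the state `φ` only serves to define `F` off
  -- `E`.
  let S : PointedCone ℝ (selfAdjoint A × selfAdjoint A) :=
    { carrier := {u | 0 ≤ (u.1 : A) ∧ 0 ≤ (u.2 : A)}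
      add_mem' := fun {u v} hu hv => ⟨add_nonneg hu.1 hv.1, add_nonneg hu.2 hv.2⟩
      zero_mem' := ⟨le_rfl, le_rfl⟩
      smul_mem' := fun c u hu => ⟨smul_nonneg c.2 hu.1, smul_nonneg c.2 hu.2⟩ }
  let E : Submodule ℝ (selfAdjoint A × selfAdjoint A) :=
    (Submodule.span ℝ {(1 : selfAdjoint A)}).comap (LinearMap.coprod .id .id)
  have hE (u v : selfAdjoint A) : (u, v) ∈ E ↔ ∃ t : ℝ, t • (1 : selfAdjoint A) = u + v :=
    Submodule.mem_span_singleton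
  let F : (selfAdjoint A × selfAdjoint A) →ₗ[ℝ] ℝ :=
    LinearMap.coprod ((‖ω‖ / 2) • w φ) ((‖ω‖ / 2) • w φ - w ω)
  have hF (u v : selfAdjoint A) : F (u, v) = ‖ω‖ / 2 * (φ (u + v : A)).re - (ω v).re := by
    simp only [F, LinearMap.coprod_apply, LinearMap.smul_apply, LinearMap.sub_apply, hw, map_add,
      Complex.add_re, smul_eq_mul]
    ring
  obtain ⟨g, hgE, hgS⟩ := riesz_extension S ⟨E, F.domRestrict E⟩ (by
    rintro ⟨⟨u, v⟩, huv⟩ ⟨hu, hv⟩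
    obtain ⟨t, ht⟩ := (hE u v).1 huv
    have ht' : algebraMap ℝ A t = u + v := by
      rw [Algebra.algebraMap_eq_smul_one]
      exact congrArg Subtype.val ht
    change 0 ≤ F (u, v)
    have hφt : (φ (u + v : A)).re = t := by
      rw [← ht', Algebra.algebraMap_eq_smul_one, ← Complex.coe_smul, map_smul, hφ1]
      simp
    have ht0 : 0 ≤ t := by
      rw [← hφt]
      exact (Complex.le_def.1 (hφ _ (add_nonneg hu hv))).1
    have h1 := norm_sub_algebraMap_le_half hv
      (by rw [ht']; exact le_add_of_nonneg_left hu) ht0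
    -- Since `ω 1 = 0`, `v` may be centred, which halves the norm bound from `t` to `t / 2`.
    have h2 : ω (v : A) = ω (v - algebraMap ℝ A (t / 2)) := by
      rw [map_sub, Algebra.algebraMap_eq_smul_one, ← Complex.coe_smul, map_smul, hω1]
      simp
    have h3 : (ω v).re ≤ ‖ω‖ * (t / 2) := by
      rw [h2]
      exact (Complex.re_le_norm _).trans (ω.le_opNorm_of_le h1)
    rw [hF, hφt]
    linarith) (by
    rintro ⟨y₁, y₂⟩
    refine ⟨⟨(‖(y₁ : A)‖ • 1, ‖(y₂ : A)‖ • 1), (hE _ _).2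
      ⟨‖(y₁ : A)‖ + ‖(y₂ : A)‖, add_smul _ _ _⟩⟩, ?_, ?_⟩
    · have := y₁.2.neg_algebraMap_norm_le_self
      rw [Algebra.algebraMap_eq_smul_one] at this
      change 0 ≤ ‖(y₁ : A)‖ • (1 : A) + y₁
      exact neg_le_iff_add_nonneg'.1 this
    · have := y₂.2.neg_algebraMap_norm_le_self
      rw [Algebra.algebraMap_eq_smul_one] at this
      change 0 ≤ ‖(y₂ : A)‖ • (1 : A) + y₂
      exact neg_le_iff_add_nonneg'.1 this)
  refine ⟨g ∘ₗ LinearMap.inl ℝ _ _, ?_, fun b hb => ⟨hgS _ ⟨hb, le_rfl⟩, ?_⟩⟩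
  · have h := hgE ⟨(1, 0), (hE _ _).2 ⟨1, by simp⟩⟩
    change g (1, 0) = F (1, 0) at h
    change g (1, 0) = _
    rw [h, hF]
    simp [hφ1]
  · have h := hgE ⟨(b, -b), (hE _ _).2 ⟨0, by simp⟩⟩
    change g (b, -b) = F (b, -b) at h
    have h2 : 0 ≤ g (0, b) := hgS _ ⟨le_rfl, hb⟩
    have h3 : g (b, 0) = g (b, -b) + g (0, b) := by rw [← map_add]; simp
    rw [hF] at h
    change _ ≤ g (b, 0)
    simp at h
    linarith

end Order

theorem exists_dominating {ψ φ : StrongDual ℂ A} (hψ : ψ ∈ stateSpace A) (hφ : φ ∈ stateSpace A) :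
    ∃ ρ : A →ₗ[ℂ] ℂ, ρ 1 = ((1 + ‖ψ - φ‖ / 2 : ℝ) : ℂ) ∧
      ∀ a, 0 ≤ ρ (star a * a) ∧ ψ (star a * a) ≤ ρ (star a * a) ∧
        φ (star a * a) ≤ ρ (star a * a) := by
  let _ := CStarAlgebra.spectralOrder A
  let _ := CStarAlgebra.spectralOrderedRing A
  obtain ⟨σ, hσ1, hσ⟩ := exists_real_dominating (ω := ψ - φ) (φ := φ) (fun a ha => by
    obtain ⟨b, rfl⟩ := CStarAlgebra.nonneg_iff_eq_star_mul_self.1 ha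
    exact hφ.1 b) hφ.2 (by simp [hψ.2, hφ.2])
  let τ : A →ₗ[ℂ] ℂ := Module.Dual.extendRCLike (𝕜 := ℂ) (σ ∘ₗ realPart)
  have hτ (b : selfAdjoint A) : τ b = σ b := by
    simp only [τ, Module.Dual.extendRCLike_apply, LinearMap.comp_apply]
    have h : realPart ((RCLike.I : ℂ) • (b : A)) = 0 := by
      simp
    rw [h, selfAdjoint.realPart_coe]
    simp
  -- On positive elements `τ ≥ 0` gives domination of `φ`, and `τ ≥ ψ - φ` gives domination of `ψ`.
  refine ⟨φ.toLinearMap + τ, ?_, fun a => ?_⟩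
  · have := hτ 1
    rw [hσ1] at this
    rw [LinearMap.add_apply]
    change φ 1 + τ ((1 : selfAdjoint A) : A) = _
    rw [this, hφ.2]
    push_cast
    rfl
  · have h1 := hτ ⟨star a * a, .star_mul_self a⟩
    obtain ⟨h2, h3⟩ := hσ ⟨star a * a, .star_mul_self a⟩ (star_mul_self_nonneg a)
    set s := σ ⟨star a * a, .star_mul_self a⟩
    have h4 := hφ.1 a
    have h5 := hψ.1 a
    simp only [LinearMap.add_apply, coe_coe] at h1 ⊢
    rw [h1]
    simp only [sub_apply, Complex.sub_re] at h3
    rw [Complex.le_def] at h4 h5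
    simp only [Complex.le_def, Complex.add_re, Complex.add_im, Complex.ofReal_re,
      Complex.ofReal_im, Complex.zero_re, Complex.zero_im] at *
    refine ⟨⟨?_, ?_⟩, ⟨?_, ?_⟩, ⟨?_, ?_⟩⟩ <;> linarith

end Bounds

/-! ### The two inequalities between fidelity and transition probability -/

section Fidelity

variable {A : Type u} [CStarAlgebra A]

theorem exists_cyclic_representation_of_mem_stateSpace {ψ : StrongDual ℂ A}
    (hψ : ψ ∈ stateSpace A) :
    ∃ (H : Type u) (_ : NormedAddCommGroup H) (_ : InnerProductSpace ℂ H) (_ : CompleteSpace H)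
      (π : A →⋆ₐ[ℂ] (H →L[ℂ] H)) (ξ : H),
      DenseRange (fun a => π a ξ) ∧ ξ ∈ implementingVectors π ψ :=
  exists_cyclic_representation ψ.toLinearMap hψ.1

theorem norm_le_one_of_mem_stateSpace {ψ : StrongDual ℂ A} (hψ : ψ ∈ stateSpace A) :
    ‖ψ‖ ≤ 1 := by
  obtain ⟨H, _, _, _, π, ξ, -, hξ⟩ := exists_cyclic_representation_of_mem_stateSpace hψ
  have hn := norm_eq_one_of_mem hψ hξ
  refine opNorm_le_bound _ zero_le_one fun a => ?_
  rw [hξ a]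
  calc _ ≤ ‖ξ‖ * ‖π a ξ‖ := norm_inner_le_norm _ _
    _ ≤ ‖ξ‖ * (‖π a‖ * ‖ξ‖) := by gcongr; exact (π a).le_opNorm ξ
    _ = ‖π a‖ := by rw [hn]; ring
    _ ≤ 1 * ‖a‖ := by rw [one_mul]; exact NonUnitalStarAlgHom.norm_apply_le π a

theorem transitionProbability_nonneg {ψ φ : StrongDual ℂ A} (hψ : ψ ∈ stateSpace A)
    (hφ : φ ∈ stateSpace A) : 0 ≤ transitionProbability ψ φ := by
  have h := norm_sub_le ψ φ
  have h1 := norm_le_one_of_mem_stateSpace hψ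
  have h2 := norm_le_one_of_mem_stateSpace hφ
  unfold transitionProbability
  nlinarith [norm_nonneg (ψ - φ)]

theorem fidelity_sq_le_transitionProbability {ψ φ : StrongDual ℂ A} (hψ : ψ ∈ stateSpace A)
    (hφ : φ ∈ stateSpace A) : fidelity ψ φ ^ 2 ≤ transitionProbability ψ φ := by
  have h0 := transitionProbability_nonneg hψ hφ
  have hnn : ∀ r ∈ fidelityValues ψ φ, 0 ≤ r := by
    rintro r ⟨H, _, _, _, π, rfl⟩
    unfold fidelityIn
    split_ifs
    · exact le_rfl
    · refine Real.sSup_nonneg ?_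
      rintro _ ⟨x, -, y, -, rfl⟩
      exact norm_nonneg _
  have hle : ∀ r ∈ fidelityValues ψ φ, r ≤ √(transitionProbability ψ φ) := by
    rintro r ⟨H, _, _, _, π, rfl⟩
    unfold fidelityIn
    split_ifs
    · exact Real.sqrt_nonneg _
    · exact Real.sSup_le (fun r hr => Real.le_sqrt_of_sq_le (overlap_sq_le hψ hφ hr))
        (Real.sqrt_nonneg _)
  calc fidelity ψ φ ^ 2 ≤ √(transitionProbability ψ φ) ^ 2 :=
        pow_le_pow_left₀ (Real.sSup_nonneg hnn) (Real.sSup_le hle (Real.sqrt_nonneg _)) 2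
    _ = _ := Real.sq_sqrt h0

theorem le_fidelity {ψ φ : StrongDual ℂ A} (hψ : ψ ∈ stateSpace A) (hφ : φ ∈ stateSpace A)
    {H : Type u} [NormedAddCommGroup H] [InnerProductSpace ℂ H] [CompleteSpace H]
    {π : A →⋆ₐ[ℂ] (H →L[ℂ] H)} {x y : H} (hx : x ∈ implementingVectors π ψ)
    (hy : y ∈ implementingVectors π φ) : ‖⟪x, y⟫_ℂ‖ ≤ fidelity ψ φ := by
  have h1 : ‖⟪x, y⟫_ℂ‖ ≤ fidelityIn π ψ φ := by
    unfold fidelityIn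
    rw [if_neg (by
      rintro (h | h)
      · exact Set.notMem_empty x (h ▸ hx)
      · exact Set.notMem_empty y (h ▸ hy))]
    exact le_csSup ⟨1, fun r hr => overlaps_le_one hψ hφ hr⟩ ⟨x, hx, y, hy, rfl⟩
  exact h1.trans (le_csSup (bddAbove_fidelityValues hψ hφ) ⟨H, _, _, _, π, rfl⟩)

theorem inner_self_eq_ofReal_norm_sq {H : Type*} [NormedAddCommGroup H] [InnerProductSpace ℂ H]
    (v : H) : ⟪v, v⟫_ℂ = ((‖v‖ ^ 2 : ℝ) : ℂ) := by
  rw [inner_self_eq_norm_sq_to_K]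
  norm_cast

/-- If `U` and `V` are contractions and `V U† U V† = c`, then `V (1 - U† U) z` is small. -/
theorem norm_defect_sq_le {H K L : Type*} [NormedAddCommGroup H] [InnerProductSpace ℂ H]
    [CompleteSpace H] [NormedAddCommGroup K] [InnerProductSpace ℂ K] [CompleteSpace K]
    [NormedAddCommGroup L] [InnerProductSpace ℂ L] [CompleteSpace L]
    {U : H →L[ℂ] K} {V : H →L[ℂ] L} (hU : ‖U‖ ≤ 1) (hV : ‖V‖ ≤ 1) {c : ℝ} (hc1 : c ≤ 1)
    (hc : ∀ y, ‖U (adjoint V y)‖ ^ 2 = c * ‖y‖ ^ 2) (z : H) :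
    ‖V z - V (adjoint U (U z))‖ ^ 2 ≤ (1 - c) * (‖z‖ ^ 2 - ‖U z‖ ^ 2) := by
  have hUle (x : H) : ‖U x‖ ≤ ‖x‖ := by simpa using U.le_of_opNorm_le hU x
  have hquad (x : H) : ⟪x, (1 - adjoint U ∘L U) x⟫_ℂ = ((‖x‖ ^ 2 - ‖U x‖ ^ 2 : ℝ) : ℂ) := by
    simp [adjoint_inner_right, inner_self_eq_norm_sq_to_K]
  have hpos : (0 : H →L[ℂ] H) ≤ 1 - adjoint U ∘L U := by
    rw [nonneg_iff_isPositive, isPositive_iff_complex]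
    intro x
    have h1 : ⟪(1 - adjoint U ∘L U) x, x⟫_ℂ = ((‖x‖ ^ 2 - ‖U x‖ ^ 2 : ℝ) : ℂ) := by
      rw [← inner_conj_symm, hquad, Complex.conj_ofReal]
    rw [h1]
    rw [RCLike.re_eq_complex_re, Complex.ofReal_re]
    refine ⟨rfl, ?_⟩
    have := pow_le_pow_left₀ (norm_nonneg _) (hUle x) 2
    exact sub_nonneg.2 this
  -- With `1 - U† U = S† S` the defect is `η = V S† S z`, so `‖η‖² = ⟨S V† η, S z⟩`, and
  -- Cauchy-Schwarz applies.
  obtain ⟨S, hS⟩ := CStarAlgebra.nonneg_iff_eq_star_mul_self.1 hpos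
  have hSn (x : H) : ‖S x‖ ^ 2 = ‖x‖ ^ 2 - ‖U x‖ ^ 2 := by
    have h1 := hquad x
    rw [hS, mul_apply_eq_comp, star_eq_adjoint, adjoint_inner_right,
      inner_self_eq_ofReal_norm_sq] at h1
    exact Complex.ofReal_injective h1
  set η := V z - V (adjoint U (U z)) with hη
  have hηS : η = V (adjoint S (S z)) := by
    have h1 := congrArg (fun T : H →L[ℂ] H => V (T z)) hS
    simpa [star_eq_adjoint, hη] using h1
  have h1 : ‖η‖ ^ 2 ≤ ‖S (adjoint V η)‖ * ‖S z‖ := by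
    have h2 : ((‖η‖ ^ 2 : ℝ) : ℂ) = ⟪S (adjoint V η), S z⟫_ℂ := by
      rw [← adjoint_inner_right, adjoint_inner_left, ← hηS, inner_self_eq_ofReal_norm_sq]
    have h3 := norm_inner_le_norm (𝕜 := ℂ) (S (adjoint V η)) (S z)
    rw [← h2, Complex.norm_real, norm_pow, norm_norm] at h3
    exact h3
  have h4 : ‖S (adjoint V η)‖ ^ 2 ≤ (1 - c) * ‖η‖ ^ 2 := by
    rw [hSn, hc]
    have h5 : ‖adjoint V η‖ ≤ ‖η‖ := by
      simpa using (adjoint V).le_of_opNorm_le (c := 1) (by simpa using hV) η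
    nlinarith [pow_le_pow_left₀ (norm_nonneg _) h5 2]
  have h6 : (‖η‖ ^ 2) ^ 2 ≤ ((1 - c) * (‖z‖ ^ 2 - ‖U z‖ ^ 2)) * ‖η‖ ^ 2 := by
    calc (‖η‖ ^ 2) ^ 2 ≤ (‖S (adjoint V η)‖ * ‖S z‖) ^ 2 :=
          pow_le_pow_left₀ (sq_nonneg _) h1 2
      _ = ‖S (adjoint V η)‖ ^ 2 * ‖S z‖ ^ 2 := mul_pow _ _ _
      _ ≤ ((1 - c) * ‖η‖ ^ 2) * ‖S z‖ ^ 2 := by gcongr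
      _ = _ := by rw [hSn]; ring
  rcases (sq_nonneg ‖η‖).eq_or_lt with h0 | h0
  · rw [← h0]
    exact mul_nonneg (sub_nonneg.2 hc1) (by rw [← hSn]; positivity)
  · exact le_of_mul_le_mul_right (by rw [← sq]; exact h6) h0

theorem transitionProbability_le_fidelity_sq {ψ φ : StrongDual ℂ A} (hψ : IsPureState ψ)
    (hφ : IsPureState φ) : transitionProbability ψ φ ≤ fidelity ψ φ ^ 2 := by
  obtain ⟨σ, hσ1, hσ⟩ := exists_dominating hψ.1 hφ.1
  obtain ⟨H, _, _, _, π, z, hzd, hz⟩ := exists_cyclic_representation σ fun a => (hσ a).1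
  obtain ⟨K, _, _, _, π₁, x, hxd, hx⟩ := exists_cyclic_representation_of_mem_stateSpace hψ.1
  obtain ⟨L, _, _, _, π₂, y, hyd, hy⟩ := exists_cyclic_representation_of_mem_stateSpace hφ.1
  have hxn := norm_eq_one_of_mem hψ.1 hx
  have hyn := norm_eq_one_of_mem hφ.1 hy
  have hsq {M : Type u} [NormedAddCommGroup M] [InnerProductSpace ℂ M] [CompleteSpace M]
      (π' : A →⋆ₐ[ℂ] (M →L[ℂ] M)) (v : M) (a : A) :
      ⟪v, π' (star a * a) v⟫_ℂ = ((‖π' a v‖ ^ 2 : ℝ) : ℂ) := by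
    rw [← inner_map_apply_map_apply, inner_self_eq_ofReal_norm_sq]
  set d := ‖ψ - φ‖ / 2 with hd
  have hd0 : 0 ≤ d := by positivity
  have hzn : ‖z‖ ^ 2 = 1 + d := by
    have h1 := hsq π z 1
    rw [star_one, one_mul, ← hz, hσ1] at h1
    simpa using (Complex.ofReal_injective h1).symm
  obtain ⟨U, hU1, hUz, hU⟩ := exists_intertwiner (ρ := π₁) (η := x) hzd fun a => by
    have h1 := (hσ a).2.1
    rw [hz, hx, hsq, hsq] at h1
    exact le_of_pow_le_pow_left₀ two_ne_zero (norm_nonneg _) (Complex.real_le_real.1 h1)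
  obtain ⟨V, hV1, hVz, hV⟩ := exists_intertwiner (ρ := π₂) (η := y) hzd fun a => by
    have h1 := (hσ a).2.2
    rw [hz, hy, hsq, hsq] at h1
    exact le_of_pow_le_pow_left₀ two_ne_zero (norm_nonneg _) (Complex.real_le_real.1 h1)
  have hUa := adjoint_intertwines hU
  have hVa := adjoint_intertwines hV
  have hcomp {M N P : Type u} [NormedAddCommGroup M] [InnerProductSpace ℂ M]
      [NormedAddCommGroup N] [InnerProductSpace ℂ N] [NormedAddCommGroup P]
      [InnerProductSpace ℂ P] (S : N →L[ℂ] P) (T : M →L[ℂ] N) (hS : ‖S‖ ≤ 1) (hT : ‖T‖ ≤ 1) :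
      ‖S ∘L T‖ ≤ 1 :=
    (opNorm_comp_le S T).trans (mul_le_one₀ hS (norm_nonneg _) hT)
  obtain ⟨c, hc0, hc⟩ := IsPureState.adjoint_comp_self_eq_smul hψ hxd hx (W := V ∘L adjoint U)
    (hcomp _ _ hV1 (by simpa using hU1)) (ρ := π₂) fun a v => by simp [hUa, hV]
  obtain ⟨c', hc'0, hc'⟩ := IsPureState.adjoint_comp_self_eq_smul hφ hyd hy
    (W := U ∘L adjoint V) (hcomp _ _ hU1 (by simpa using hV1)) (ρ := π₁)
    fun a v => by simp [hVa, hU]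
  simp only [comp_apply] at hc hc'
  have hcn (v : K) : ‖V (adjoint U v)‖ ^ 2 = c * ‖v‖ ^ 2 := by
    have h1 := hc v v
    rw [inner_self_eq_ofReal_norm_sq, inner_self_eq_ofReal_norm_sq] at h1
    exact_mod_cast h1
  have hcn' (v : L) : ‖U (adjoint V v)‖ ^ 2 = c' * ‖v‖ ^ 2 := by
    have h1 := hc' v v
    rw [inner_self_eq_ofReal_norm_sq, inner_self_eq_ofReal_norm_sq] at h1
    exact_mod_cast h1
  set w := V (adjoint U x) with hw
  have hwn : ‖w‖ ^ 2 = c := by rw [hw, hcn, hxn]; ring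
  have hc1 : c ≤ 1 := by
    have h1 := (V ∘L adjoint U).le_of_opNorm_le (hcomp _ _ hV1 (by simpa using hU1)) x
    rw [hxn, mul_one] at h1
    exact hwn ▸ pow_le_one₀ (norm_nonneg _) h1
  -- Computing `‖U V† w‖²` and `‖V U† U V† y‖²` in two ways gives `c² = c' c` and `c'² = c c'`, so
  -- `(c - c')² = 0`.
  have hcc : c = c' := by
    have h1 : U (adjoint V w) = (c : ℂ) • x := by
      refine ext_inner_left ℂ fun v => ?_
      rw [← adjoint_inner_left, adjoint_inner_right, hw, hc, inner_smul_right]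
    have h2 : V (adjoint U (U (adjoint V y))) = (c' : ℂ) • y := by
      refine ext_inner_left ℂ fun v => ?_
      rw [← adjoint_inner_left, adjoint_inner_right, hc', inner_smul_right]
    have h3 := hcn' w
    have h4 := hcn (U (adjoint V y))
    rw [h1, norm_smul, hxn, hwn, Complex.norm_real, mul_one, Real.norm_eq_abs, sq_abs] at h3
    rw [h2, norm_smul, hyn, hcn', hyn, Complex.norm_real, mul_one, Real.norm_eq_abs, sq_abs] at h4
    nlinarith [sq_nonneg (c - c')]
  subst hcc
  have hdef := norm_defect_sq_le hU1 hV1 hc1 hcn' z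
  rw [hUz, hVz, hzn, hxn, ← hw] at hdef
  have hexp := norm_sub_sq (𝕜 := ℂ) y w
  rw [hyn, hwn] at hexp
  have hT : transitionProbability ψ φ = 1 - d ^ 2 := by
    unfold transitionProbability
    rw [hd]; ring
  rw [hT]
  rcases hc0.eq_or_lt with h0 | h0
  -- If `c = 0`, the defect bound reads `1 ≤ d`, so `1 - d² ≤ 0`.
  · have hw0 : w = 0 := by simpa [← h0] using hwn
    rw [hw0] at hexp hdef
    simp [← h0, hyn] at hdef
    nlinarith [sq_nonneg (fidelity ψ φ)]
  · have hs : 0 < √c := Real.sqrt_pos.2 h0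
    have hsc : √c ^ 2 = c := Real.sq_sqrt hc0
    have hmem : (((√c)⁻¹ : ℝ) : ℂ) • w ∈ implementingVectors π₂ ψ := by
      intro a
      rw [map_smul, inner_smul_left, inner_smul_right, hw, ← hV, ← hUa, hc, ← hx a,
        Complex.conj_ofReal, ← mul_assoc, ← mul_assoc]
      have : (√c)⁻¹ * (√c)⁻¹ * c = 1 := by
        rw [← hsc, Real.sqrt_sq hs.le]; field_simp
      rw [← Complex.ofReal_mul, ← Complex.ofReal_mul, this]
      simp
    have hF := le_fidelity hψ.1 hφ.1 hmem hy
    rw [inner_smul_left, Complex.conj_ofReal, norm_mul, Complex.norm_real, Real.norm_of_nonneg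
      (by positivity), norm_inner_symm, inv_mul_le_iff₀ hs] at hF
    have hre := (RCLike.re_le_norm ⟪y, w⟫_ℂ).trans hF
    have hF0 : 0 ≤ fidelity ψ φ := by
      have := (norm_nonneg _).trans hF
      exact nonneg_of_mul_nonneg_right this hs
    have h1 : (1 - d) + c * (1 + d) ≤ 2 * √c * fidelity ψ φ := by
      nlinarith
    rcases le_or_gt 1 d with hd1 | hd1
    · nlinarith [sq_nonneg (fidelity ψ φ)]
    · have h2 : 4 * c * ((1 - d) * (1 + d)) ≤ (2 * √c * fidelity ψ φ) ^ 2 := by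
        have h3 : 0 ≤ (1 - d) + c * (1 + d) := by nlinarith
        -- AM-GM for `1 - d` and `c (1 + d)`, in the form `4pq ≤ (p + q)²`.
        nlinarith [pow_le_pow_left₀ h3 h1 2, sq_nonneg ((1 - d) - c * (1 + d))]
      rw [mul_pow, mul_pow, hsc] at h2
      nlinarith

end Fidelity

theorem proposition3 {A : Type u} [CStarAlgebra A] (ψ φ : StrongDual ℂ A)
    (hψ : CStarState.IsPureState ψ) (hφ : CStarState.IsPureState φ) :
    CStarState.transitionProbability ψ φ = CStarState.fidelity ψ φ ^ 2 :=
  le_antisymm (transitionProbability_le_fidelity_sq hψ hφ)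
    (fidelity_sq_le_transitionProbability hψ.1 hφ.1)
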